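/- Throughout, let $2^{<\omega}$ denote the set of finite binary strings, and identify a set $X\subseteq\omega$ with its characteristic function. A \emph{relative c.e. operator} is a c.e. set $\Theta\subseteq 2^{<\omega}\times\omega$; for $X\subseteq\omega$ let $\Theta(X)$ be the set of $x$ such that $(\sigma,x)\in\Theta$ for some initial segment $\sigma$ of $X$. A set $A$ is c.e. relative to $X$ if $A=\Theta(X)$ for some relative c.e. operator $\Theta$. We say that $A$ is \emph{uniformly introenumerable} from $C$ if there is a single relative c.e. operator $\Theta$ such that $\Theta(D)=A$ for every infinite $D\subseteq C$. A class $\mathcal C$ of subsets of $\omega$ is $\Sigma^1_1(B)$ if there is a computable relation $R$ such that for all $X\subseteq\omega$: $X\in\mathcal C$ if and only if there is $f\in\omega^\omega$ such that $R(X{\restriction}n,B{\restriction}n,f{\restriction}n)$ holds for all $n$. **Theorem.** Let $A,B\subseteq\omega$ with $B$ infinite, and suppose that $A$ is c.e. relative to every infinite subset of $B$. Then there is a nonempty $\Sigma^1_1(B)$ class $\mathcal C$ such that every $C\in\mathcal C$ is an infinite subset of $B$ from which $A$ is uniformly introenumerable. -/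

import Mathlib

namespace Intro

open Classical in
/-- The initial segment of length `n` of the characteristic function of `X`,
as a binary string. -/
noncomputable def segment (X : Set ℕ) (n : ℕ) : List Bool :=
  (List.range n).map fun i => decide (i ∈ X)

/-- The initial segment of length `n` of a function `f : ℕ → ℕ`. -/
def funSegment (f : ℕ → ℕ) (n : ℕ) : List ℕ :=
  (List.range n).map f

/-- `[B]^ω`: the collection of infinite subsets of `B`. -/
def infSubsets (B : Set ℕ) : Set (Set ℕ) :=
  {C | C ⊆ B ∧ C.Infinite}

/-- A relative c.e. operator: a c.e. set of pairs `(σ, x)`, each of which says that `x` is to be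
enumerated from every oracle extending the binary string `σ`. -/
structure CEOperator where
  pairs : Set (List Bool × ℕ)
  ce : REPred fun p : List Bool × ℕ => p ∈ pairs

/-- The set `Θ(X)` enumerated by `Θ` from the oracle `X`: all `x` with `(σ, x) ∈ Θ` for some
initial segment `σ` of `X`. -/
def CEOperator.enum (Θ : CEOperator) (X : Set ℕ) : Set ℕ :=
  {x | ∃ n, (segment X n, x) ∈ Θ.pairs}

/-- `A` is c.e. relative to `X`. -/
def CEIn (A X : Set ℕ) : Prop :=
  ∃ Θ : CEOperator, Θ.enum X = A

/-- `A` is introenumerable from `B`: it is c.e. relative to every infinite subset of `B`. -/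
def IntroCE (A B : Set ℕ) : Prop :=
  ∀ C ∈ infSubsets B, CEIn A C

/-- `A` is uniformly introenumerable from `B`: a single relative c.e. operator enumerates `A`
from every infinite subset of `B`. -/
def UniformIntroCE (A B : Set ℕ) : Prop :=
  ∃ Θ : CEOperator, ∀ C ∈ infSubsets B, Θ.enum C = A

/-- `𝒞` is a (lightface) `Σ¹₁(B)` class of sets of natural numbers: there is a computable relation
`R` on triples of strings such that
`X ∈ 𝒞 ↔ ∃ f : ℕ → ℕ, ∀ n, R (X ↾ n, B ↾ n, f ↾ n)`. -/
def IsSigmaOneOneIn (B : Set ℕ) (𝒞 : Set (Set ℕ)) : Prop :=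
  ∃ R : List Bool × List Bool × List ℕ → Prop, ComputablePred R ∧
    ∀ X : Set ℕ, X ∈ 𝒞 ↔
      ∃ f : ℕ → ℕ, ∀ n, R (segment X n, segment B n, funSegment f n)

end Intro

/-! This is Mathias-style forcing. A condition is a nonempty class of infinite subsets of `B` that
avoid a c.e. set of strings; they share a finite stem, and the class is closed under infinite
subsets with that stem. Such a class is Σ¹₁(B) (`isSigmaOneOneIn_avoiding`).

Suppose that no condition's class works. Then any condition can be extended so that a given `Θ` errs
(`exists_extends_forcesNe`). If `Θ` enumerates a wrong element from some member, the use is frozen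
into the stem. If for some `x ∈ A` there is a member with no infinite subset, sharing the stem, from
which `Θ` enumerates `x`, only such members are kept; this again means avoiding a c.e. set. If
neither case occurs, searching through subsets enumerates `A` uniformly, contrary to assumption.
Treating all of the countably many operators while adding elements yields in the limit
(`exists_limit`) an infinite `D ⊆ B` relative to which `A` is not c.e. -/

namespace PrimrecPred

/-! ### Primitive recursive and c.e. predicates. -/

variable {α : Type*} {β : Type*} [Primcodable α] [Primcodable β]

theorem forall_lt_of_pred {f : α → ℕ} {p : α × ℕ → Prop} (hp : PrimrecPred p) (hf : Primrec f) :
    PrimrecPred fun a => ∀ i < f a, p (a, i) :=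
  ((PrimrecRel.forall_mem_list (R := fun i a => p (a, i))
    (hp.comp (Primrec.snd.pair Primrec.fst))).comp (Primrec.list_range.comp hf) Primrec.id).of_eq
    fun a => by simp

theorem imp {p q : α → Prop} (hp : PrimrecPred p) (hq : PrimrecPred q) :
    PrimrecPred fun a => p a → q a :=
  (hp.not.or hq).of_eq fun _ => imp_iff_not_or.symm

/-- The projection of a primitive recursive relation is recursively enumerable. -/
theorem exists_re {q : α × β → Prop} (hq : PrimrecPred q) : REPred fun a => ∃ b, q (a, b) := by
  classical
  have hg : Primrec₂ fun (a : α) (n : ℕ) =>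
      (Encodable.decode (α := β) n).bind fun b => if q (a, b) then some b else none := by
    refine Primrec.option_bind (Primrec.decode.comp Primrec.snd) ?_
    exact Primrec.ite (hq.comp ((Primrec.fst.comp Primrec.fst).pair Primrec.snd))
      (Primrec.option_some.comp Primrec.snd) (Primrec.const none)
  refine (Partrec.rfindOpt hg.to_comp).dom_re.of_eq fun a => ?_
  rw [Nat.rfindOpt_dom]
  constructor
  · rintro ⟨n, b, h⟩
    rw [Option.mem_def, Option.bind_eq_some_iff] at h
    obtain ⟨c, -, h⟩ := h
    split_ifs at h with hc
    exact ⟨c, hc⟩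
  · rintro ⟨b, hb⟩
    exact ⟨Encodable.encode b, b, by simp [hb]⟩

end PrimrecPred

section REPred

open Nat.Partrec (Code)

variable {α : Type*} [Primcodable α]

theorem REPred.exists_code {p : α → Prop} (hp : REPred p) :
    ∃ c : Code, ∀ a, p a ↔ (c.eval (Encodable.encode a)).Dom := by
  obtain ⟨c, hc⟩ := Code.exists_code.1 hp
  refine ⟨c, fun a => ?_⟩
  rw [hc]
  simp [Encodable.encodek, Part.assert]

/-- The witness `n` bounds the running time of a code for `p`. -/
theorem REPred.exists_primrec {p : α → Prop} (hp : REPred p) :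
    ∃ q : α × ℕ → Prop, PrimrecPred q ∧ ∀ a, p a ↔ ∃ n, q (a, n) := by
  obtain ⟨c, hc⟩ := hp.exists_code
  refine ⟨fun b => (Code.evaln b.2 c (Encodable.encode b.1)).isSome = true, ?_, fun a => ?_⟩
  · refine Primrec.eq.comp (Primrec.option_isSome.comp ?_) (Primrec.const true)
    exact Code.primrec_evaln.comp
      ((Primrec.snd.pair (Primrec.const c)).pair (Primrec.encode.comp Primrec.fst))
  · simp only [hc, Part.dom_iff_mem, Code.evaln_complete, Option.isSome_iff_exists, Option.mem_def]
    exact exists_comm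

theorem PrimrecPred.to_re {p : α → Prop} (hp : PrimrecPred p) : REPred p :=
  hp.computablePred.to_re

theorem REPred.or {p q : α → Prop} (hp : REPred p) (hq : REPred q) :
    REPred fun a => p a ∨ q a := by
  obtain ⟨p', hp', hpp⟩ := hp.exists_primrec
  obtain ⟨q', hq', hqq⟩ := hq.exists_primrec
  refine (hp'.or hq').exists_re.of_eq fun a => ?_
  rw [exists_or, hpp, hqq]

theorem REPred.comp_primrec {β : Type*} [Primcodable β] {p : β → Prop} (hp : REPred p) {f : α → β}
    (hf : Primrec f) : REPred fun a => p (f a) :=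
  Partrec.comp hp hf.to_comp

end REPred

namespace Intro

theorem infinite_of_forall_exists_ge {X : Set ℕ} (h : ∀ n, ∃ i ∈ X, n ≤ i) : X.Infinite :=
  Set.infinite_of_forall_exists_gt fun n => h (n + 1)

instance : Countable CEOperator := by
  choose c hc using fun Θ : CEOperator => Θ.ce.exists_code
  refine Function.Injective.countable (f := c) fun Θ Ψ h => ?_
  have : Θ.pairs = Ψ.pairs := by
    ext p
    rw [hc Θ p, hc Ψ p, h]
  cases Θ
  cases Ψ
  simpa using this

/-! ### Initial segments. -/

section Segment

variable {X Y : Set ℕ} {m n i : ℕ}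

@[simp]
theorem length_segment (X : Set ℕ) (n : ℕ) : (segment X n).length = n := by
  simp [segment]

@[simp]
theorem length_funSegment (f : ℕ → ℕ) (n : ℕ) : (funSegment f n).length = n := by
  simp [funSegment]

theorem getElem?_segment_eq_true : (segment X n)[i]? = some true ↔ i < n ∧ i ∈ X := by
  simp [segment, List.getElem?_eq_some_iff]

theorem getElem?_segment_eq_false : (segment X n)[i]? = some false ↔ i < n ∧ i ∉ X := by
  simp [segment, List.getElem?_eq_some_iff]

theorem getElem?_funSegment {f : ℕ → ℕ} (h : i < n) : (funSegment f n)[i]? = some (f i) := by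
  simp [funSegment, h]

/-- `X` and `Y` have the same elements below `m`. -/
def Agree (m : ℕ) (X Y : Set ℕ) : Prop :=
  ∀ i < m, i ∈ X ↔ i ∈ Y

theorem segment_eq_iff : segment X n = segment Y n ↔ Agree n X Y := by
  simp [segment, Agree]

theorem eq_segment_iff {l : List Bool} :
    l = segment X n ↔ l.length = n ∧ ∀ i < n, l[i]? = some true ↔ i ∈ X := by
  constructor
  · rintro rfl
    exact ⟨length_segment X n, fun i hi => by rw [getElem?_segment_eq_true, and_iff_right hi]⟩
  · rintro ⟨rfl, h⟩
    refine List.ext_getElem (by simp) fun i hi _ => ?_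
    have := h i hi
    rw [List.getElem?_eq_getElem hi] at this
    rw [Bool.eq_iff_iff]
    simpa [segment] using this

theorem take_segment : (segment X n).take m = segment X (min m n) := by
  simp [segment, ← List.map_take, List.take_range]

theorem Agree.symm (h : Agree m X Y) : Agree m Y X :=
  fun i hi => (h i hi).symm

theorem Agree.trans {Z : Set ℕ} (h : Agree m X Y) (h' : Agree m Y Z) : Agree m X Z :=
  fun i hi => (h i hi).trans (h' i hi)

theorem Agree.mono (h : Agree n X Y) (hmn : m ≤ n) : Agree m X Y :=
  fun i hi => h i (hi.trans_le hmn)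

end Segment

theorem primrecPred_getElem?_eq_some {α β : Type*} [Primcodable α] [Primcodable β]
    {f : α → List β} {g : α → ℕ} (hf : Primrec f) (hg : Primrec g) (b : β) :
    PrimrecPred fun a => (f a)[g a]? = some b :=
  Primrec.eq.comp (Primrec.list_getElem?.comp hf hg) (Primrec.const (some b))

/-! ### Classes avoiding a c.e. set of strings are Σ¹₁(B). -/

/-- The infinite subsets of `B` that have no initial segment in `V`. -/
def avoiding (B : Set ℕ) (V : List Bool → Prop) : Set (Set ℕ) :=
  {X | X ∈ infSubsets B ∧ ∀ n, ¬ V (segment X n)}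

/-- The matrix of a `Σ¹₁` definition of `avoiding B V`, where `V σ ↔ ∃ j, q (σ, j)`: the function
coordinate witnesses that the set is infinite. -/
def avoidingMatrix (q : List Bool × ℕ → Prop) (p : List Bool × List Bool × List ℕ) : Prop :=
  (∀ i < p.1.length, p.1[i]? = some true → p.2.1[i]? = some true) ∧
  (∀ i < p.2.2.length, i ≤ p.2.2[i]?.getD 0 ∧ ¬ p.1[p.2.2[i]?.getD 0]? = some false) ∧
  ∀ i < p.1.length, ∀ j < p.1.length, ¬ q (p.1.take i, j)

theorem primrecPred_avoidingMatrix {q : List Bool × ℕ → Prop} (hq : PrimrecPred q) :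
    PrimrecPred (avoidingMatrix q) := by
  have h₁ : Primrec fun b : (List Bool × List Bool × List ℕ) × ℕ => b.1.1 :=
    Primrec.fst.comp Primrec.fst
  have h₂ : Primrec fun b : (List Bool × List Bool × List ℕ) × ℕ => b.1.2.1 :=
    Primrec.fst.comp (Primrec.snd.comp Primrec.fst)
  have h₃ : Primrec fun b : (List Bool × List Bool × List ℕ) × ℕ => b.1.2.2 :=
    Primrec.snd.comp (Primrec.snd.comp Primrec.fst)
  have hv : Primrec fun b : (List Bool × List Bool × List ℕ) × ℕ => b.1.2.2[b.2]?.getD 0 :=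
    Primrec.option_getD.comp (Primrec.list_getElem?.comp h₃ Primrec.snd) (Primrec.const 0)
  have hlen : Primrec fun p : List Bool × List Bool × List ℕ => p.1.length :=
    Primrec.list_length.comp Primrec.fst
  have hsub := PrimrecPred.forall_lt_of_pred
    ((primrecPred_getElem?_eq_some h₁ Primrec.snd true).imp
      (primrecPred_getElem?_eq_some h₂ Primrec.snd true)) hlen
  have hinf := PrimrecPred.forall_lt_of_pred
    ((Primrec.nat_le.comp Primrec.snd hv).and (primrecPred_getElem?_eq_some h₁ hv false).not)
    (Primrec.list_length.comp (Primrec.snd.comp Primrec.snd))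
  have hav := PrimrecPred.forall_lt_of_pred (PrimrecPred.forall_lt_of_pred
    (p := fun b : ((List Bool × List Bool × List ℕ) × ℕ) × ℕ => ¬ q (b.1.1.1.take b.1.2, b.2))
    (hq.comp ((Primrec.list_take.comp (Primrec.snd.comp Primrec.fst)
      (h₁.comp Primrec.fst)).pair Primrec.snd)).not (hlen.comp Primrec.fst)) hlen
  exact hsub.and (hinf.and hav)

theorem isSigmaOneOneIn_avoiding (B : Set ℕ) {V : List Bool → Prop} (hV : REPred V) :
    IsSigmaOneOneIn B (avoiding B V) := by
  obtain ⟨q, hq, hVq⟩ := hV.exists_primrec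
  refine ⟨avoidingMatrix q, (primrecPred_avoidingMatrix hq).computablePred, fun X => ?_⟩
  simp only [avoidingMatrix, length_segment, length_funSegment, getElem?_segment_eq_true,
    getElem?_segment_eq_false, take_segment]
  constructor
  · rintro ⟨⟨hXB, hX⟩, hav⟩
    choose f hfX hf using fun n => hX.exists_gt n
    refine ⟨f, fun n => ⟨fun i hi h => ⟨hi, hXB h.2⟩, fun i hi => ?_, fun i _ j _ h => ?_⟩⟩
    · rw [getElem?_funSegment hi]
      exact ⟨(hf i).le, fun h => h.2 (hfX i)⟩
    · exact hav _ ((hVq _).2 ⟨j, h⟩)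
  · rintro ⟨f, hf⟩
    refine ⟨⟨fun i hi => ?_, ?_⟩, fun n hn => ?_⟩
    · exact ((hf (i + 1)).1 i i.lt_succ_self ⟨i.lt_succ_self, hi⟩).2
    · refine infinite_of_forall_exists_ge fun i => ⟨f i, ?_, ?_⟩
      -- The matrix accepts positions beyond the segment of `X`, so the length must exceed `f i` as
      -- well as `i`.
      · have h := ((hf (max (f i) i + 1)).2.1 i (by omega)).2
        rw [getElem?_funSegment (by omega)] at h
        by_contra hi
        exact h ⟨by simp only [Option.getD_some]; omega, hi⟩
      · have h := ((hf (i + 1)).2.1 i i.lt_succ_self).1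
        rwa [getElem?_funSegment i.lt_succ_self] at h
    · obtain ⟨j, hj⟩ := (hVq _).1 hn
      refine (hf (max n j + 1)).2.2 n (by omega) j (by omega) ?_
      rwa [min_eq_left (by omega)]

/-! ### Searching through subsets of the oracle. -/

/-- The operator enumerating from `X` everything that `Θ` enumerates from a finite set which agrees
with `T` below `m` and is contained in `X` from `m` on. -/
def CEOperator.below (Θ : CEOperator) (T : Set ℕ) (m : ℕ) : CEOperator where
  pairs := {p | ∃ k υ, ((segment T m ++ υ).take k, p.2) ∈ Θ.pairs ∧
    ∀ i < υ.length, υ[i]? = some true → p.1[m + i]? = some true}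
  ce := by
    obtain ⟨q, hq, hΘ⟩ := Θ.ce.exists_primrec
    let W := (List Bool × ℕ) × (ℕ × List Bool × ℕ)
    have hυ : Primrec fun w : W => w.2.2.1 :=
      Primrec.fst.comp (Primrec.snd.comp Primrec.snd)
    have h₁ : PrimrecPred fun w : W =>
        q (((segment T m ++ w.2.2.1).take w.2.1, w.1.2), w.2.2.2) :=
      hq.comp (((Primrec.list_take.comp (Primrec.fst.comp Primrec.snd)
        (Primrec.list_append.comp (Primrec.const _) hυ)).pair
          (Primrec.snd.comp Primrec.fst)).pair (Primrec.snd.comp (Primrec.snd.comp Primrec.snd)))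
    have h₂ : PrimrecPred fun w : W => ∀ i < w.2.2.1.length,
        w.2.2.1[i]? = some true → w.1.1[m + i]? = some true :=
      PrimrecPred.forall_lt_of_pred
        (p := fun b : W × ℕ => b.1.2.2.1[b.2]? = some true → b.1.1.1[m + b.2]? = some true)
        ((primrecPred_getElem?_eq_some (hυ.comp Primrec.fst) Primrec.snd true).imp
          (primrecPred_getElem?_eq_some (Primrec.fst.comp (Primrec.fst.comp Primrec.fst))
            (Primrec.nat_add.comp (Primrec.const m) Primrec.snd) true))
        (Primrec.list_length.comp hυ)
    refine (h₁.and h₂).exists_re.of_eq fun p => ?_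
    constructor
    · rintro ⟨⟨k, υ, j⟩, h, h'⟩
      exact ⟨k, υ, (hΘ _).2 ⟨j, h⟩, h'⟩
    · rintro ⟨k, υ, h, h'⟩
      obtain ⟨j, hj⟩ := (hΘ _).1 h
      exact ⟨⟨k, υ, j⟩, hj, h'⟩

/-- Only a finite part of the subset is used, so past that part it can be continued by `X` itself,
which makes it infinite. -/
theorem CEOperator.mem_enum_below {Θ : CEOperator} {T X : Set ℕ} {m x : ℕ} (hX : X.Infinite) :
    x ∈ (Θ.below T m).enum X ↔
      ∃ D : Set ℕ, D.Infinite ∧ Agree m T D ∧ (∀ i ∈ D, m ≤ i → i ∈ X) ∧ x ∈ Θ.enum D := by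
  constructor
  · rintro ⟨n, k, υ, hΘ, hυ⟩
    have hlen : (segment T m ++ υ).length = m + υ.length := by simp
    let D : Set ℕ := {i | (segment T m ++ υ)[i]? = some true ∨ m + υ.length ≤ i ∧ i ∈ X}
    have hD : segment T m ++ υ = segment D (m + υ.length) := by
      refine eq_segment_iff.2 ⟨hlen, fun i hi => ?_⟩
      simp only [D, Set.mem_ofPred_eq]
      exact ⟨Or.inl, fun h => h.resolve_right fun h => absurd h.1 (by omega)⟩
    refine ⟨D, ?_, fun i hi => ?_, ?_, ?_⟩
    · refine (hX.sdiff (Set.finite_lt_nat (m + υ.length))).mono ?_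
      rintro i ⟨hi, hlt⟩
      exact Or.inr ⟨not_lt.1 hlt, hi⟩
    · simp only [D, Set.mem_ofPred_eq]
      rw [List.getElem?_append_left (by simpa using hi), getElem?_segment_eq_true]
      exact ⟨fun h => Or.inl ⟨hi, h⟩, fun h => (h.resolve_right fun h => absurd h.1 (by omega)).2⟩
    · rintro i (hi | hi) hmi
      · rw [List.getElem?_append_right (by simpa using hmi), length_segment] at hi
        have hlt := (List.getElem?_eq_some_iff.1 hi).1
        have := hυ _ hlt hi
        rw [Nat.add_sub_cancel' hmi] at this
        exact (getElem?_segment_eq_true.1 this).2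
      · exact hi.2
    · refine ⟨min k (m + υ.length), ?_⟩
      rwa [← take_segment, ← hD]
  · rintro ⟨D, -, hTD, hDX, k, hk⟩
    -- The use `k` may be shorter than the stem, hence `max k m`.
    have happ : segment T m ++ (segment D (max k m)).drop m = segment D (max k m) := by
      rw [segment_eq_iff.2 hTD]
      conv_rhs => rw [← List.take_append_drop m (segment D (max k m))]
      rw [take_segment, min_eq_left (le_max_right _ _)]
    refine ⟨max k m, k, (segment D (max k m)).drop m, ?_, fun i _ h => ?_⟩
    · rw [happ, take_segment, min_eq_left (le_max_left _ _)]
      exact hk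
    · rw [List.getElem?_drop] at h
      obtain ⟨h₁, h₂⟩ := getElem?_segment_eq_true.1 h
      exact getElem?_segment_eq_true.2 ⟨h₁, hDX _ h₂ (Nat.le_add_right _ _)⟩

/-! ### Forcing conditions and their extensions. -/

/-- A nonempty class `avoiding B V`, with `V` c.e., all of whose members have the same stem, namely
the part of `stem` below `len`, and which is closed under infinite subsets with that stem. -/
structure Condition (B : Set ℕ) where
  stem : Set ℕ
  len : ℕ
  V : List Bool → Prop
  re : REPred V
  nonempty : (avoiding B V).Nonempty
  agree : ∀ X ∈ avoiding B V, Agree len stem X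
  down : ∀ X ∈ avoiding B V, ∀ D ⊆ X, D.Infinite → Agree len stem D → D ∈ avoiding B V

namespace Condition

variable {A B : Set ℕ}

/-- The class of sets satisfying a condition. -/
def sets (c : Condition B) : Set (Set ℕ) :=
  avoiding B c.V

/-- `d` has a longer stem and fewer sets than `c`. -/
def Extends (d c : Condition B) : Prop :=
  c.len ≤ d.len ∧ d.sets ⊆ c.sets

/-- `d` forces that `Θ` does not enumerate `A`. -/
def ForcesNe (d : Condition B) (Θ : CEOperator) (A : Set ℕ) : Prop :=
  ∀ D : Set ℕ, Agree d.len d.stem D → (∀ n, ∃ X ∈ d.sets, Agree n X D) → Θ.enum D ≠ A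

/-- The condition obtained by lengthening the stem to `X` below `n`. -/
def lengthen (c : Condition B) {X : Set ℕ} (hX : X ∈ c.sets) {n : ℕ} (hn : c.len ≤ n) :
    Condition B where
  stem := X
  len := n
  V σ := c.V σ ∨ σ.length = n ∧ ¬ σ = segment X n
  re := c.re.or <| PrimrecPred.to_re <|
    (Primrec.eq.comp Primrec.list_length (Primrec.const n)).and
      (Primrec.eq.comp Primrec.id (Primrec.const (segment X n))).not
  nonempty := by
    refine ⟨X, hX.1, fun k hk => hk.elim (hX.2 k) ?_⟩
    rintro ⟨hk, h⟩
    rw [length_segment] at hk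
    exact h (hk ▸ rfl)
  agree Y hY := by
    by_contra h
    exact hY.2 n (Or.inr ⟨length_segment Y n, fun h' => h (segment_eq_iff.1 h'.symm)⟩)
  down Y hY D hD hinf hag := by
    have hYc : Y ∈ c.sets := ⟨hY.1, fun k hk => hY.2 k (Or.inl hk)⟩
    have hDc := c.down Y hYc D hD hinf (((c.agree X hX)).trans (hag.mono hn))
    refine ⟨hDc.1, fun k hk => hk.elim (hDc.2 k) ?_⟩
    rintro ⟨hk, h⟩
    rw [length_segment] at hk
    subst hk
    exact h (segment_eq_iff.2 hag.symm)

theorem lengthen_extends (c : Condition B) {X : Set ℕ} (hX : X ∈ c.sets) {n : ℕ}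
    (hn : c.len ≤ n) : (c.lengthen hX hn).Extends c :=
  ⟨hn, fun _ hY => ⟨hY.1, fun k hk => hY.2 k (Or.inl hk)⟩⟩

/-- The condition obtained by keeping only those sets `X` such that `Θ` does not enumerate `x` from
any infinite subset of `X` with the same stem. -/
def omitting (c : Condition B) (Θ : CEOperator) (x : ℕ)
    (h : ∃ X ∈ c.sets, x ∉ (Θ.below c.stem c.len).enum X) : Condition B where
  stem := c.stem
  len := c.len
  V σ := c.V σ ∨ (σ, x) ∈ (Θ.below c.stem c.len).pairs
  re := c.re.or ((Θ.below c.stem c.len).ce.comp_primrec (Primrec.id.pair (Primrec.const x)))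
  nonempty := by
    obtain ⟨X, hX, hx⟩ := h
    exact ⟨X, hX.1, fun k hk => hk.elim (hX.2 k) fun hk => hx ⟨k, hk⟩⟩
  agree X hX := c.agree X ⟨hX.1, fun k hk => hX.2 k (Or.inl hk)⟩
  down X hX D hD hinf hag := by
    have hDc := c.down X ⟨hX.1, fun k hk => hX.2 k (Or.inl hk)⟩ D hD hinf hag
    refine ⟨hDc.1, fun k hk => hk.elim (hDc.2 k) fun hk => ?_⟩
    obtain ⟨E, h₁, h₂, h₃, h₄⟩ := (CEOperator.mem_enum_below hinf).1 ⟨k, hk⟩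
    obtain ⟨n, hn⟩ := (CEOperator.mem_enum_below hX.1.2).2
      ⟨E, h₁, h₂, fun i hi hm => hD (h₃ i hi hm), h₄⟩
    exact hX.2 n (Or.inr hn)

/-- If a condition cannot be extended to make `Θ` err, then `Θ.below` enumerates `A` from all
subsets of its sets. -/
theorem uniformIntroCE (c : Condition B) (Θ : CEOperator)
    (h₁ : ∀ X ∈ c.sets, Θ.enum X ⊆ A)
    (h₂ : ∀ X ∈ c.sets, A ⊆ (Θ.below c.stem c.len).enum X) {C : Set ℕ} (hC : C ∈ c.sets) :
    UniformIntroCE A C := by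
  refine ⟨Θ.below c.stem c.len, fun D hD => Set.Subset.antisymm (fun x hx => ?_) fun x hx => ?_⟩
  · obtain ⟨E, hE, hag, hED, hxE⟩ := (CEOperator.mem_enum_below hD.2).1 hx
    refine h₁ E (c.down C hC E (fun i hi => ?_) hE hag) hxE
    rcases lt_or_ge i c.len with h | h
    · exact (c.agree C hC i h).1 ((hag i h).2 hi)
    · exact hD.1 (hED i hi h)
  -- `D` may lack the stem; restoring it gives a member of the class, and `Θ.below` ignores the
  -- oracle below `c.len`.
  · let E : Set ℕ := {i | i < c.len ∧ i ∈ c.stem ∨ c.len ≤ i ∧ i ∈ D}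
    have hE : E ∈ c.sets := by
      refine c.down C hC E ?_ ?_ fun i hi => ?_
      · rintro i (⟨hi, h⟩ | ⟨-, h⟩)
        · exact (c.agree C hC i hi).1 h
        · exact hD.1 h
      · refine (hD.2.sdiff (Set.finite_lt_nat c.len)).mono ?_
        rintro i ⟨hi, hlt⟩
        exact Or.inr ⟨not_lt.1 hlt, hi⟩
      · exact ⟨fun h => Or.inl ⟨hi, h⟩, fun h =>
          (h.resolve_right fun h => absurd h.1 (by omega)).2⟩
    obtain ⟨F, hF, hag, hFE, hxF⟩ := (CEOperator.mem_enum_below hE.1.2).1 (h₂ E hE hx)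
    refine (CEOperator.mem_enum_below hD.2).2 ⟨F, hF, hag, fun i hi hm => ?_, hxF⟩
    exact ((hFE i hi hm).resolve_left fun h => absurd h.1 (by omega)).2

theorem exists_extends_forcesNe
    (hno : ∀ c : Condition B, ∃ C ∈ c.sets, ¬ UniformIntroCE A C)
    (c : Condition B) (Θ : CEOperator) : ∃ d : Condition B, d.Extends c ∧ d.ForcesNe Θ A := by
  by_cases h₁ : ∀ X ∈ c.sets, Θ.enum X ⊆ A
  · by_cases h₂ : ∀ X ∈ c.sets, A ⊆ (Θ.below c.stem c.len).enum X
    · obtain ⟨C, hC, hCn⟩ := hno c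
      exact absurd (c.uniformIntroCE Θ h₁ h₂ hC) hCn
    · simp only [not_forall, Set.not_subset] at h₂
      obtain ⟨X, hX, x, hxA, hx⟩ := h₂
      refine ⟨c.omitting Θ x ⟨X, hX, hx⟩,
        ⟨le_rfl, fun Y hY => ⟨hY.1, fun k hk => hY.2 k (Or.inl hk)⟩⟩, ?_⟩
      -- If `x` were in `Θ(D)`, a member `Y` agreeing with `D` up to the use would enumerate `x`
      -- too, with `Y` serving as its own subset.
      rintro D - hD rfl
      obtain ⟨k, hk⟩ := hxA
      obtain ⟨Y, hY, hYD⟩ := hD k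
      obtain ⟨n, hn⟩ := (CEOperator.mem_enum_below hY.1.2).2 ⟨Y, hY.1.2,
        (c.omitting Θ x ⟨X, hX, hx⟩).agree Y hY, fun i hi _ => hi, k,
        by rwa [segment_eq_iff.2 hYD]⟩
      exact hY.2 n (Or.inr hn)
  · simp only [not_forall, Set.not_subset] at h₁
    obtain ⟨X, hX, x, ⟨k, hk⟩, hxA⟩ := h₁
    refine ⟨c.lengthen hX (le_max_right k c.len), c.lengthen_extends _ _, ?_⟩
    rintro D hD - rfl
    refine hxA ⟨k, ?_⟩
    rwa [← segment_eq_iff.2 (hD.mono (le_max_left _ _))]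

theorem exists_extends_new_mem (c : Condition B) :
    ∃ d : Condition B, d.Extends c ∧ ∃ i ∈ d.stem, c.len ≤ i ∧ i < d.len := by
  obtain ⟨X, hX⟩ := c.nonempty
  obtain ⟨i, hi, hlt⟩ := hX.1.2.exists_gt c.len
  exact ⟨c.lengthen hX (hlt.le.trans i.le_succ), c.lengthen_extends _ _, i, hi, hlt.le,
    i.lt_succ_self⟩

theorem Extends.trans {c d e : Condition B} (h : e.Extends d) (h' : d.Extends c) : e.Extends c :=
  ⟨h'.1.trans h.1, h.2.trans h'.2⟩

theorem Extends.agree {c d : Condition B} (h : d.Extends c) : Agree c.len c.stem d.stem := by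
  obtain ⟨X, hX⟩ := d.nonempty
  exact (c.agree X (h.2 hX)).trans ((d.agree X hX).mono h.1).symm

/-- The condition satisfied by all infinite subsets of `B`. -/
def univ (hB : B.Infinite) : Condition B where
  stem := ∅
  len := 0
  V _ := False
  re := (ComputablePred.computable_iff.2 ⟨fun _ => false, Computable.const false, by simp⟩).to_re
  nonempty := ⟨B, ⟨subset_rfl, hB⟩, fun _ => id⟩
  agree _ _ _ hi := absurd hi (Nat.not_lt_zero _)
  down _ hX _ hD hinf _ := ⟨⟨hD.trans hX.1.1, hinf⟩, fun _ => id⟩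

/-- A decreasing sequence of conditions that keeps adding elements has a limit. -/
theorem exists_limit (c : ℕ → Condition B) (hc : ∀ n, (c (n + 1)).Extends (c n))
    (hnew : ∀ n, ∃ i ∈ (c (n + 1)).stem, (c n).len ≤ i ∧ i < (c (n + 1)).len) :
    ∃ D ∈ infSubsets B, ∀ n, Agree (c n).len (c n).stem D ∧
      ∀ k, ∃ X ∈ (c n).sets, Agree k X D := by
  have hext : ∀ n k, (c (n + k)).Extends (c n) := fun n k => by
    induction k with
    | zero => exact ⟨le_rfl, subset_rfl⟩
    | succ k ih => exact (hc (n + k)).trans ih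
  have hlen : ∀ n, n ≤ (c n).len := fun n => by
    induction n with
    | zero => exact Nat.zero_le _
    | succ n ih =>
      obtain ⟨i, -, h₁, h₂⟩ := hnew n
      omega
  have hag : ∀ n k, Agree (c n).len (c n).stem (c (n + k)).stem := fun n k => (hext n k).agree
  -- Since `i < (c (i + 1)).len`, membership of `i` is settled by stage `i + 1`.
  let D : Set ℕ := {i | i ∈ (c (i + 1)).stem}
  have hD : ∀ n, Agree (c n).len (c n).stem D := fun n i hi => by
    have hi' : i < (c (i + 1)).len := hlen (i + 1)
    rcases le_total n (i + 1) with h | h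
    · obtain ⟨k, hk⟩ := Nat.exists_eq_add_of_le h
      have := hag n k i hi
      rwa [← hk] at this
    · obtain ⟨k, hk⟩ := Nat.exists_eq_add_of_le h
      have := hag (i + 1) k i hi'
      rw [← hk] at this
      exact this.symm
  have happ : ∀ n k, ∃ X ∈ (c n).sets, Agree k X D := fun n k => by
    obtain ⟨X, hX⟩ := (c (n + k)).nonempty
    refine ⟨X, (hext n k).2 hX, ?_⟩
    exact (((c (n + k)).agree X hX).symm.trans (hD (n + k))).mono
      ((Nat.le_add_left k n).trans (hlen _))
  refine ⟨D, ⟨fun i hi => ?_, ?_⟩, fun n => ⟨hD n, happ n⟩⟩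
  · obtain ⟨X, hX, hXD⟩ := happ 0 (i + 1)
    exact hX.1.1 ((hXD i i.lt_succ_self).2 hi)
  · refine infinite_of_forall_exists_ge fun n => ?_
    obtain ⟨i, hi, h₁, h₂⟩ := hnew n
    exact ⟨i, (hD (n + 1) i h₂).1 hi, (hlen n).trans h₁⟩

theorem exists_uniformIntroCE (hB : B.Infinite) (hAB : IntroCE A B) :
    ∃ c : Condition B, ∀ C ∈ c.sets, UniformIntroCE A C := by
  by_contra! hno
  have : Nonempty CEOperator :=
    let ⟨Θ, _⟩ := hAB B ⟨subset_rfl, hB⟩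
    ⟨Θ⟩
  obtain ⟨Θ, hΘ⟩ := exists_surjective_nat CEOperator
  choose f hf hfne using fun c n => exists_extends_forcesNe hno c (Θ n)
  choose g hg hgnew using exists_extends_new_mem (B := B)
  -- Each stage adds an element by `g`, making the limit infinite, then defeats the `n`th operator
  -- by `f`.
  let c : ℕ → Condition B := Nat.rec (univ hB) fun n c => f (g c) n
  have hstep : ∀ n, c (n + 1) = f (g (c n)) n := fun _ => rfl
  obtain ⟨D, hDB, hD⟩ := exists_limit c (fun n => (hf _ n).trans (hg _)) fun n => by
    obtain ⟨i, hi, h₁, h₂⟩ := hgnew (c n)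
    rw [hstep]
    exact ⟨i, ((hf (g (c n)) n).agree i h₂).1 hi, h₁, h₂.trans_le (hf _ n).1⟩
  obtain ⟨Ψ, hΨ⟩ := hAB D hDB
  obtain ⟨n, rfl⟩ := hΘ Ψ
  exact hfne (g (c n)) n D (hD (n + 1)).1 (hD (n + 1)).2 hΨ

end Condition

end Intro

theorem mainTheorem7 (A B : Set ℕ) (hB : B.Infinite) (hAB : Intro.IntroCE A B) :
    ∃ 𝒞 : Set (Set ℕ), Intro.IsSigmaOneOneIn B 𝒞 ∧ 𝒞.Nonempty ∧
      ∀ C ∈ 𝒞, C ∈ Intro.infSubsets B ∧ Intro.UniformIntroCE A C := by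
  obtain ⟨c, hc⟩ := Intro.Condition.exists_uniformIntroCE hB hAB
  exact ⟨c.sets, Intro.isSigmaOneOneIn_avoiding B c.re, c.nonempty,
    fun C hC => ⟨hC.1, hc C hC⟩⟩
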